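/- Let $m\ge 2$ and let $\mathcal A=(a_{i_1i_2\cdots i_m})$, $i_1,\dots,i_m\in N=\{1,\dots,n\}$, be a complex tensor of order $m$ and dimension $n$. For $i\in N$ put $$r_i(\mathcal A)=\sum_{\substack{i_2,\dots,i_m\in N\\ (i_2,\dots,i_m)\ne(i,\dots,i)}}|a_{ii_2\cdots i_m}| .$$ The determinant $\det(\mathcal A)$ is the resultant of the ordered system of $n$ homogeneous polynomials of degree $m-1$ in $x_1,\dots,x_n$ $$(\mathcal A x^{m-1})_i=\sum_{i_2,\dots,i_m\in N}a_{ii_2\cdots i_m}x_{i_2}\cdots x_{i_m},\qquad i\in N .$$ Here the resultant of $n$ forms of degree $d\ge 1$ in $n$ variables is the value, at the coefficients of the forms, of the generic resultant: with $F_1,\dots,F_n$ the generic forms of degree $d$, whose coefficients are indeterminates $u$, it is the unique polynomial in $\mathbb Z[u]$ that generates the ideal $\{r\in\mathbb Z[u] : x_k^{M}r\in(F_1,\dots,F_n)\subseteq\mathbb Z[u][x]\text{ for all }k\text{ and some }M\}$ and takes the value $1$ at the system $x_1^d,\dots,x_n^d$. Suppose that for each $i\in N$, either $$|a_{i\cdots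 i}|>r_i(\mathcal A)$$ or $$|a_{j\cdots j}|<2|a_{ji\cdots i}|-r_j(\mathcal A)\quad\text{for some } j\in N,\ j\ne i .$$ Then $\det(\mathcal A)\ne 0$. -/

import Mathlib

open MvPolynomial

noncomputable section

namespace TensorDet

/-- Tensors of order `m` and dimension `n` with entries in `K`. -/
abbrev Tensor (K : Type*) (m n : ℕ) : Type _ := (Fin m → Fin n) → K

/-! ### The resultant of `n` forms of degree `d` in `n` variables -/

/-- The exponent vectors of the monomials of degree `d` in `n` variables. -/
abbrev Expo (n d : ℕ) : Type :=
  {α : Fin n →₀ ℕ // α ∈ (Finset.univ : Finset (Fin n)).finsuppAntidiag d}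

/-- The ring `ℤ[u]`, with one indeterminate `u_{i,α}` for each form `i` and each monomial `x^α` of
degree `d`. -/
abbrev CoeffRing (n d : ℕ) : Type := MvPolynomial (Fin n × Expo n d) ℤ

/-- The generic form `F_i = ∑_{|α| = d} u_{i,α} x^α`. -/
def genericForm (n d : ℕ) (i : Fin n) : MvPolynomial (Fin n) (CoeffRing n d) :=
  ∑ α : Expo n d, monomial α.1 (X (i, α))

/-- The ideal of `ℤ[u][x]` generated by the generic forms `F_1, …, F_n`. -/
def genericIdeal (n d : ℕ) : Ideal (MvPolynomial (Fin n) (CoeffRing n d)) :=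
  Ideal.span (Set.range (genericForm n d))

/-- The ideal of inertia forms of degree `0` (the elimination ideal, or resultant ideal) in `ℤ[u]`:
those `r ∈ ℤ[u]` such that, for some `N`, all the products `x_k ^ N * r` lie in
`(F_1, …, F_n)`. -/
def inertiaIdeal (n d : ℕ) : Ideal (CoeffRing n d) where
  carrier := {r | ∃ N : ℕ, ∀ k : Fin n, X k ^ N * C r ∈ genericIdeal n d}
  zero_mem' := ⟨0, fun k => by simp⟩
  add_mem' := by
    rintro r s ⟨N, hN⟩ ⟨M, hM⟩
    refine ⟨N + M, fun k => ?_⟩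
    have h : (X k ^ (N + M) * C (r + s) : MvPolynomial (Fin n) (CoeffRing n d)) =
        X k ^ M * (X k ^ N * C r) + X k ^ N * (X k ^ M * C s) := by
      rw [C_add]; ring
    rw [h]
    exact add_mem (Ideal.mul_mem_left _ _ (hN k)) (Ideal.mul_mem_left _ _ (hM k))
  smul_mem' := by
    rintro c r ⟨N, hN⟩
    refine ⟨N, fun k => ?_⟩
    have h : (X k ^ N * C (c • r) : MvPolynomial (Fin n) (CoeffRing n d)) =
        C c * (X k ^ N * C r) := by
      rw [smul_eq_mul, C_mul]; ring
    rw [h]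
    exact Ideal.mul_mem_left _ _ (hN k)

/-- The coefficients of the system of forms `x_1^d, …, x_n^d`. -/
def purePowers (n d : ℕ) : Fin n × Expo n d → ℤ :=
  fun p => if p.2.1 = Finsupp.single p.1 d then 1 else 0

/-- `R ∈ ℤ[u]` is the generic resultant of `n` forms of degree `d` in `n` variables: it generates
the ideal of inertia forms, and it takes the value `1` at the system `x_1^d, …, x_n^d`. -/
def IsGenericResultant (n d : ℕ) (R : CoeffRing n d) : Prop :=
  inertiaIdeal n d = Ideal.span {R} ∧ eval (purePowers n d) R = 1

/-- There is at most one generic resultant. -/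
theorem IsGenericResultant.unique {n d : ℕ} {R S : CoeffRing n d}
    (hR : IsGenericResultant n d R) (hS : IsGenericResultant n d S) : R = S := by
  have h : Associated R S := Ideal.span_singleton_eq_span_singleton.1 (hR.1.symm.trans hS.1)
  obtain ⟨u, rfl⟩ := h
  obtain ⟨z, -, hz⟩ := MvPolynomial.isUnit_iff_eq_C_of_isReduced.1 u.isUnit
  have h1 := hS.2
  rw [hz, map_mul, hR.2, eval_C, one_mul] at h1
  rw [hz, h1, C_1, mul_one]

open Classical in
/-- The generic resultant (with the value `0` should there be none). -/
def genericResultant (n d : ℕ) : CoeffRing n d :=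
  if h : ∃ R, IsGenericResultant n d R then h.choose else 0

/-- The resultant of the forms `f_1, …, f_n` of degree `d` in `n` variables: the generic resultant,
evaluated at the coefficients of the forms. -/
def resultant {K : Type*} [CommRing K] {n : ℕ} (d : ℕ) (f : Fin n → MvPolynomial (Fin n) K) : K :=
  aeval (fun p : Fin n × Expo n d => coeff p.2.1 (f p.1)) (genericResultant n d)

/-! ### Tensors of order `m = d + 1` -/

/-- The `i`-th form of the system `A x^{m-1}`, of degree `d = m - 1`, namely
`∑ a_{i i_2 … i_m} x_{i_2} ⋯ x_{i_m}`. -/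
def tensorForm {K : Type*} [CommRing K] {d n : ℕ} (A : Tensor K (d + 1) n) (i : Fin n) :
    MvPolynomial (Fin n) K :=
  ∑ α : Fin d → Fin n, C (A (Fin.cons i α)) * ∏ k, X (α k)

/-- The determinant of a tensor: the resultant of the system `A x^{m-1} = 0`. -/
def det {K : Type*} [CommRing K] {d n : ℕ} (A : Tensor K (d + 1) n) : K :=
  resultant d (tensorForm A)

/-- `r_i(A)`: the sum of the `|a_{i i_2 … i_m}|` over all `(i_2, …, i_m) ≠ (i, …, i)`. -/
def offDiagSum {d n : ℕ} (A : Tensor ℂ (d + 1) n) (i : Fin n) : ℝ :=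
  ∑ α : Fin d → Fin n with α ≠ fun _ => i, ‖A (Fin.cons i α)‖

end TensorDet

end

/-!
Let `I ⊆ ℤ[u]` be the ideal of inertia forms. That the generic resultant exists means that `I` is
principal, with a generator taking the value `± 1` at `x_1 ^ d, …, x_n ^ d`.

After inverting `x_k`, the equations `F_i = 0` can be solved for the coefficients of `x_k ^ d`.
Hence `I` is the kernel of a ring homomorphism from `ℤ[u]` to the domain `ℤ[u][x][1/x_k]`, and it
is prime. Moreover no nonzero element of `I` avoids the coefficient of `x_k ^ d` in `F_k`: there are
systems with a nontrivial zero all of whose other coefficients are algebraically independent. A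
prime ideal of a polynomial ring `A[t]` over a factorial ring `A` which meets `A` in `0` is
principal.

If forms over a field have no common zero but the origin, then the Nullstellensatz puts all
monomials of some degree in the ideal they generate, so that a maximal minor of their Macaulay
matrix is not zero. The corresponding minor of the generic forms is a multiple of the generator of
`I`, which is therefore not zero at these forms. For `x_1 ^ d, …, x_n ^ d` modulo every prime number
this shows that the value of the generator is `± 1`; in general it shows that the resultant is not
zero.

The hypothesis of the theorem says that for each `i` some equation of the system has a coefficient
of `x_i ^ d` which dominates all its other terms. At a common zero whose `i`-th coordinate is the
largest this equation would fail, unless the zero is the origin.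
-/

noncomputable section

namespace TensorDet

/-! ### Prime ideals and algebraic independence -/

/-- Modulo a prime element `f` of `P`, the polynomial ring is algebraic over `A`, so that a nonzero
element of `P / (f)` would give a nonzero element of `P ∩ A`. -/
theorem isPrincipal_of_comap_C_eq_bot {A : Type*} [CommRing A] [IsDomain A]
    [UniqueFactorizationMonoid A] {P : Ideal (Polynomial A)} (hP : P.IsPrime)
    (hPA : P.comap Polynomial.C = ⊥) : P.IsPrincipal := by
  rcases eq_or_ne P ⊥ with rfl | hbot
  · exact inferInstance
  obtain ⟨f, hfP, hf⟩ := hP.exists_mem_prime_of_ne_bot hbot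
  refine ⟨f, le_antisymm ?_ ((Ideal.span_singleton_le_iff_mem _).2 hfP)⟩
  have : IsDomain (AdjoinRoot f) := AdjoinRoot.isDomain_of_prime hf
  have halg : Algebra.IsAlgebraic A (AdjoinRoot f) := by
    have h : (Algebra.adjoin A {AdjoinRoot.root f}).IsAlgebraic :=
      Algebra.isAlgebraic_adjoin_singleton_iff.2 (AdjoinRoot.isAlgebraic_root hf.ne_zero)
    exact ⟨fun x => h x (AdjoinRoot.adjoinRoot_eq_top.ge trivial)⟩
  have hker : RingHom.ker (AdjoinRoot.mk f) ≤ P := by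
    intro g hg
    exact P.mem_of_dvd (AdjoinRoot.mk_eq_zero.1 hg) hfP
  have hcomap : (P.map (AdjoinRoot.mk f)).comap (algebraMap A (AdjoinRoot f)) = ⊥ := by
    rw [AdjoinRoot.algebraMap_eq, AdjoinRoot.of, ← Ideal.comap_comap,
      Ideal.comap_map_of_surjective _ AdjoinRoot.mk_surjective]
    exact (congrArg _ (sup_eq_left.2 hker)).trans hPA
  have hmap : P.map (AdjoinRoot.mk f) = ⊥ := by
    by_contra hne
    obtain ⟨x, hx, hx0⟩ := Submodule.exists_mem_ne_zero_of_ne_bot hne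
    exact Ideal.comap_ne_bot_of_algebraic_mem hx0 hx (halg.isAlgebraic x) hcomap
  intro g hg
  rw [Ideal.submodule_span_eq, Ideal.mem_span_singleton, ← AdjoinRoot.mk_eq_zero]
  exact (Submodule.eq_bot_iff _).1 hmap _ (Ideal.mem_map_of_mem _ hg)

theorem isPrincipal_of_comap_rename_eq_bot {σ R : Type*} [CommRing R] [IsDomain R]
    [UniqueFactorizationMonoid R] (p₀ : σ) {P : Ideal (MvPolynomial σ R)} (hP : P.IsPrime)
    (hPσ : P.comap (rename (R := R) (Subtype.val : {p // p ≠ p₀} → σ)) = ⊥) : P.IsPrincipal := by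
  classical
  let e : Polynomial (MvPolynomial {p // p ≠ p₀} R) ≃ₐ[R] MvPolynomial σ R :=
    (optionEquivLeft R {p // p ≠ p₀}).symm.trans (renameEquiv R (Equiv.optionSubtypeNe p₀))
  have he (q) : e (Polynomial.C q) = rename Subtype.val q := by
    induction q using MvPolynomial.induction_on with
    | C a => simp [e, optionEquivLeft_symm_C_C]
    | add q₁ q₂ h₁ h₂ => simp only [map_add, h₁, h₂]
    | mul_X q p h =>
      rw [map_mul, map_mul, map_mul, h]
      simp [e, optionEquivLeft_symm_C_X]
  have hC : (P.comap e).comap Polynomial.C = ⊥ := by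
    rw [← hPσ]
    ext q
    rw [Ideal.mem_comap, Ideal.mem_comap, Ideal.mem_comap, he]
  have := isPrincipal_of_comap_C_eq_bot (hP.comap e) hC
  exact Ideal.IsPrincipal.of_comap e e.surjective P

/-- For the weights given by the degrees of the `f p`, the coefficient of top degree of the value
at `f` of a polynomial is the value at the leading coefficients of its part of top weight. -/
theorem algebraicIndependent_of_leadingCoeff {σ R K : Type*} [CommRing R] [CommRing K] [IsDomain K]
    [Algebra R K] {f : σ → Polynomial K}
    (h : AlgebraicIndependent R fun p => (f p).leadingCoeff) : AlgebraicIndependent R f := by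
  nontriviality R
  rw [algebraicIndependent_iff]
  intro s hs
  by_contra hs0
  let w : σ → ℕ := fun p => (f p).natDegree
  have hf0 (p) : f p ≠ 0 := Polynomial.leadingCoeff_ne_zero.1 (h.ne_zero p)
  have hdeg (α : σ →₀ ℕ) : (α.prod fun p m => f p ^ m).natDegree = Finsupp.weight w α := by
    rw [Finsupp.prod, Polynomial.natDegree_prod _ _ fun p _ => pow_ne_zero _ (hf0 p)]
    simp [Finsupp.weight_apply, Finsupp.sum, w]
  have hlead (α : σ →₀ ℕ) : (α.prod fun p m => f p ^ m).leadingCoeff =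
      α.prod fun p m => (f p).leadingCoeff ^ m := by
    simp [Finsupp.prod, Polynomial.leadingCoeff_prod]
  obtain ⟨β, hβ, hmax⟩ :=
    s.support.exists_max_image (Finsupp.weight w) (support_nonempty.2 hs0)
  have htop : weightedHomogeneousComponent w (Finsupp.weight w β) s = 0 := by
    refine algebraicIndependent_iff.1 h _ ?_
    rw [← Polynomial.coeff_zero (Finsupp.weight w β), ← hs, weightedHomogeneousComponent_apply,
      Finset.sum_filter, map_sum]
    conv_rhs => rw [s.as_sum, map_sum, Polynomial.finsetSum_coeff]
    refine Finset.sum_congr rfl fun α hα => ?_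
    rw [aeval_monomial, Polynomial.algebraMap_apply, Polynomial.coeff_C_mul]
    split_ifs with hw
    · rw [aeval_monomial, ← hlead, Polynomial.leadingCoeff, hdeg, hw]
    · rw [map_zero, Polynomial.coeff_eq_zero_of_natDegree_lt, mul_zero]
      exact (hdeg α).trans_lt ((hmax α hα).lt_of_ne hw)
  have := congrArg (coeff β) htop
  rw [coeff_weightedHomogeneousComponent, if_pos rfl, coeff_zero] at this
  exact mem_support_iff.1 hβ this

/-! ### Maximal minors -/

theorem det_smul_mem_span {κ S V : Type*} [Fintype κ] [DecidableEq κ] [CommRing S] [AddCommGroup V]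
    [Module S V] (M : Matrix κ κ S) (v : κ → V) (b : κ) :
    M.det • v b ∈ Submodule.span S (Set.range fun c => ∑ b', M c b' • v b') := by
  have h : M.det • v b = ∑ c, M.adjugate b c • ∑ b', M c b' • v b' := by
    calc M.det • v b = ∑ b', (M.adjugate * M) b b' • v b' := by
          simp [Matrix.adjugate_mul, Matrix.one_apply]
      _ = ∑ c, M.adjugate b c • ∑ b', M c b' • v b' := by
          simp only [Matrix.mul_apply, Finset.sum_smul, Finset.smul_sum, mul_smul]
          exact Finset.sum_comm
  rw [h]
  exact sum_mem fun c _ => Submodule.smul_mem _ _ (Submodule.subset_span ⟨c, rfl⟩)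

theorem exists_det_submatrix_ne_zero {ι κ K : Type*} [Field K] [Fintype κ] [DecidableEq κ]
    {M : Matrix ι κ K} (hM : Submodule.span K (Set.range M.row) = ⊤) :
    ∃ a : κ → ι, (M.submatrix a id).det ≠ 0 := by
  obtain ⟨ι', a, -, hspan, hli⟩ := exists_linearIndependent' K M.row
  let b := Module.Basis.mk hli (hspan.trans hM).ge
  let e : κ ≃ ι' := (Pi.basisFun K κ).indexEquiv b
  have hrows : LinearIndependent K (M.submatrix (a ∘ e) id).row := hli.comp e e.injective
  exact ⟨a ∘ e, ((Matrix.isUnit_iff_isUnit_det _).1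
    (Matrix.linearIndependent_rows_iff_isUnit.1 hrows)).ne_zero⟩

/-! ### Forms and their coefficients -/

variable {n d : ℕ}

theorem mem_finsuppAntidiag_univ_iff {β : Fin n →₀ ℕ} :
    β ∈ (Finset.univ : Finset (Fin n)).finsuppAntidiag d ↔ β.degree = d := by
  simp [Finsupp.degree_eq_sum]

theorem Expo.degree_eq (α : Expo n d) : α.1.degree = d :=
  mem_finsuppAntidiag_univ_iff.1 α.2

/-- The exponent vector of the pure power `x_k ^ d`. -/
def pureExpo (n d : ℕ) (k : Fin n) : Expo n d :=
  ⟨Finsupp.single k d, by simp⟩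

theorem pureExpo_injective (hd : 1 ≤ d) : Function.Injective (pureExpo n d) :=
  fun _ _ h => Finsupp.single_left_injective (by omega) (congrArg Subtype.val h)

section Forms

variable {S T : Type*} [CommRing S] [CommRing T]

theorem monomial_pureExpo (k : Fin n) (a : S) :
    monomial (pureExpo n d k).1 a = C a * X k ^ d := by
  rw [X_pow_eq_monomial, C_mul_monomial, mul_one, pureExpo]

theorem sum_monomial_coeff_of_isHomogeneous {q : MvPolynomial (Fin n) S}
    (hq : q.IsHomogeneous d) : ∑ α : Expo n d, monomial α.1 (coeff α.1 q) = q := by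
  ext β
  simp only [coeff_sum, coeff_monomial]
  by_cases hβ : β.degree = d
  · rw [Finset.sum_eq_single_of_mem ⟨β, mem_finsuppAntidiag_univ_iff.2 hβ⟩ (Finset.mem_univ _)
      fun α _ hα => if_neg fun h => hα (Subtype.ext h)]
    exact if_pos rfl
  · rw [hq.coeff_eq_zero hβ]
    exact Finset.sum_eq_zero fun α _ => if_neg fun h => hβ (by rw [← h, α.degree_eq])

/-- The forms `f_i = ∑_{|α| = d} u_{i,α} x^α` of degree `d` with given coefficients `u`; the
coefficients are arranged as in `CoeffRing n d`, whose indeterminates give the generic forms. -/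
def formOfCoeffs (u : Fin n × Expo n d → S) (i : Fin n) : MvPolynomial (Fin n) S :=
  ∑ α : Expo n d, monomial α.1 (u (i, α))

theorem isHomogeneous_formOfCoeffs (u : Fin n × Expo n d → S) (i : Fin n) :
    (formOfCoeffs u i).IsHomogeneous d :=
  IsHomogeneous.sum _ _ _ fun α _ => isHomogeneous_monomial _ α.degree_eq

theorem formOfCoeffs_coeff {f : Fin n → MvPolynomial (Fin n) S}
    (hf : ∀ i, (f i).IsHomogeneous d) :
    formOfCoeffs (fun p : Fin n × Expo n d => coeff p.2.1 (f p.1)) = f :=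
  funext fun i => sum_monomial_coeff_of_isHomogeneous (hf i)

theorem map_formOfCoeffs (φ : S →+* T) (u : Fin n × Expo n d → S) (i : Fin n) :
    map φ (formOfCoeffs u i) = formOfCoeffs (fun p => φ (u p)) i := by
  simp only [formOfCoeffs, map_sum, map_monomial]

theorem map_aeval_genericForm (u : Fin n × Expo n d → S) (i : Fin n) :
    map (aeval u : CoeffRing n d →ₐ[ℤ] S).toRingHom (genericForm n d i) = formOfCoeffs u i := by
  refine (map_formOfCoeffs _ X i).trans ?_
  congr 1
  exact funext (aeval_X u)

theorem formOfCoeffs_eq_add_of_forall_ne {u v : Fin n × Expo n d → S} {i l : Fin n}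
    (h : ∀ α, α ≠ pureExpo n d l → v (i, α) = u (i, α)) :
    formOfCoeffs v i =
      formOfCoeffs u i + C (v (i, pureExpo n d l) - u (i, pureExpo n d l)) * X l ^ d := by
  rw [← sub_eq_iff_eq_add', formOfCoeffs, formOfCoeffs, ← Finset.sum_sub_distrib,
    Finset.sum_eq_single_of_mem (pureExpo n d l) (Finset.mem_univ _) fun α _ hα => by
      rw [h α hα, sub_self],
    ← map_sub, monomial_pureExpo]

theorem formOfCoeffs_purePowers (i : Fin n) :
    formOfCoeffs (fun p => (purePowers n d p : S)) i = X i ^ d := by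
  have h (α) (hα : α ≠ pureExpo n d i) : (purePowers n d (i, α) : S) = 0 := by
    have hα' : α.1 ≠ Finsupp.single i d := fun h => hα (Subtype.ext h)
    simp [purePowers, hα']
  rw [formOfCoeffs_eq_add_of_forall_ne (u := fun _ => 0) h]
  simp [formOfCoeffs, purePowers, pureExpo]

theorem aeval_eq_zero_of_X_pow_mul_C_mem [NoZeroDivisors S] {r : CoeffRing n d} {N : ℕ} {k : Fin n}
    (hr : X k ^ N * C r ∈ genericIdeal n d) {u : Fin n × Expo n d → S} {x : Fin n → S}
    (hu : ∀ i, eval x (formOfCoeffs u i) = 0) (hx : x k ≠ 0) : aeval u r = 0 := by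
  have hker : genericIdeal n d ≤
      RingHom.ker ((eval x).comp (map (aeval u : CoeffRing n d →ₐ[ℤ] S).toRingHom)) := by
    rw [genericIdeal, Ideal.span_le]
    rintro _ ⟨i, rfl⟩
    rw [SetLike.mem_coe, RingHom.mem_ker, RingHom.comp_apply, map_aeval_genericForm, hu]
  have h : x k ^ N * aeval u r = 0 := by
    simpa only [RingHom.mem_ker, RingHom.comp_apply, map_mul, map_pow, map_X, map_C, eval_X, eval_C]
      using! hker hr
  exact (mul_eq_zero.1 h).resolve_left (pow_ne_zero N hx)

/-- The coefficients of the forms `f_i - x_k⁻ᵈ f_i(x) X_k ^ d`, where the `f_i` have the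
coefficients `u`. If `x_k` is a unit, then these forms vanish at `x`, and they differ from the `f_i`
only in the coefficients of `X_k ^ d`. -/
def adjustCoeffs (k : Fin n) (u : Fin n × Expo n d → S) (x : Fin n → S) (p : Fin n × Expo n d) :
    S :=
  if p.2 = pureExpo n d k then u p - Ring.inverse (x k) ^ d * eval x (formOfCoeffs u p.1) else u p

theorem eval_formOfCoeffs_adjustCoeffs {k : Fin n} {x : Fin n → S} (hx : IsUnit (x k))
    (u : Fin n × Expo n d → S) (i : Fin n) :
    eval x (formOfCoeffs (adjustCoeffs k u x) i) = 0 := by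
  rw [formOfCoeffs_eq_add_of_forall_ne (u := u) (l := k) fun α hα => if_neg hα]
  have hinv : Ring.inverse (x k) ^ d * x k ^ d = 1 := by
    rw [← mul_pow, Ring.inverse_mul_cancel _ hx, one_pow]
  simp only [adjustCoeffs, if_true, map_add, map_mul, map_pow, eval_C, eval_X]
  linear_combination (-eval x (formOfCoeffs u i)) * hinv

end Forms

/-! ### The ideal of inertia forms is prime -/

/-- The ring `ℤ[u][x]` in which the generic forms live. -/
abbrev GenericRing (n d : ℕ) : Type := MvPolynomial (Fin n) (CoeffRing n d)

section GenericZero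

variable (d) (B : Type*) [CommRing B] [Algebra (GenericRing n d) B]

/-- The coefficients of the generic system with a zero whose `k`-th coordinate is a unit: in an
algebra `B` over `ℤ[u][x]`, such as `ℤ[u][x][1/x_k]`, the coefficients of `x_k ^ d` in the generic
forms are corrected so that the generic point `x` becomes a zero. -/
def genericZeroCoeffs (k : Fin n) : Fin n × Expo n d → B :=
  adjustCoeffs k (fun p => algebraMap (GenericRing n d) B (C (X p)))
    fun l => algebraMap (GenericRing n d) B (X l)

theorem eval_algebraMap_X_formOfCoeffs (i : Fin n) :
    eval (fun l => algebraMap (GenericRing n d) B (X l))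
      (formOfCoeffs (fun p => algebraMap (GenericRing n d) B (C (X p))) i) =
      algebraMap _ B (genericForm n d i) := by
  have h : (eval fun l => algebraMap (GenericRing n d) B (X l)).comp
      (map ((algebraMap (GenericRing n d) B).comp C)) = algebraMap (GenericRing n d) B :=
    ringHom_ext (fun r => by rw [RingHom.comp_apply, map_C, eval_C, RingHom.comp_apply])
      fun l => by rw [RingHom.comp_apply, map_X, eval_X]
  have hmap : map ((algebraMap (GenericRing n d) B).comp C) (genericForm n d i) =
      formOfCoeffs (fun p => algebraMap (GenericRing n d) B (C (X p))) i :=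
    map_formOfCoeffs ((algebraMap (GenericRing n d) B).comp C) X i
  rw [← hmap, ← RingHom.comp_apply, h]

variable (k : Fin n) [IsLocalization.Away (X k : GenericRing n d) B]

theorem eval_formOfCoeffs_genericZeroCoeffs (i : Fin n) :
    eval (fun l => algebraMap (GenericRing n d) B (X l))
      (formOfCoeffs (genericZeroCoeffs d B k) i) = 0 :=
  eval_formOfCoeffs_adjustCoeffs (IsLocalization.Away.algebraMap_isUnit (X k : GenericRing n d)) _ i

theorem aeval_genericZeroCoeffs_eq_zero_of_mem {l : Fin n} {N : ℕ} {r : CoeffRing n d}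
    (hr : X l ^ N * C r ∈ genericIdeal n d) : aeval (genericZeroCoeffs d B k) r = 0 := by
  have hX := powers_le_nonZeroDivisors_of_noZeroDivisors
    (X_ne_zero k : (X k : GenericRing n d) ≠ 0)
  have : IsDomain B := IsLocalization.isDomain_of_le_nonZeroDivisors B hX
  refine aeval_eq_zero_of_X_pow_mul_C_mem hr (eval_formOfCoeffs_genericZeroCoeffs d B k) ?_
  rw [Ne, IsLocalization.to_map_eq_zero_iff B hX]
  exact X_ne_zero l

theorem exists_X_pow_mul_C_mem_of_aeval_genericZeroCoeffs_eq_zero {r : CoeffRing n d}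
    (hr : aeval (genericZeroCoeffs d B k) r = 0) : ∃ N, X k ^ N * C r ∈ genericIdeal n d := by
  let I : Ideal B := (genericIdeal n d).map (algebraMap _ B)
  have hF (i : Fin n) : algebraMap _ B (genericForm n d i) ∈ I :=
    Ideal.mem_map_of_mem _ (Ideal.subset_span ⟨i, rfl⟩)
  -- The correction of the coefficients is a multiple of a generic form, so it vanishes modulo `I`.
  have hcomp : (Ideal.Quotient.mk I).comp (aeval (genericZeroCoeffs d B k)).toRingHom =
      (Ideal.Quotient.mk I).comp ((algebraMap (GenericRing n d) B).comp C) := by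
    refine ringHom_ext' (RingHom.ext_int _ _) fun p => Ideal.Quotient.eq.2 ?_
    simp only [AlgHom.toRingHom_eq_coe, RingHom.coe_coe, aeval_X, RingHom.comp_apply,
      genericZeroCoeffs, adjustCoeffs, eval_algebraMap_X_formOfCoeffs]
    split_ifs
    · rw [sub_sub_cancel_left]
      exact I.neg_mem (I.mul_mem_left _ (hF p.1))
    · rw [sub_self]
      exact I.zero_mem
  have hmem : algebraMap (GenericRing n d) B (C r) ∈ I := by
    rw [← Ideal.Quotient.eq_zero_iff_mem]
    refine (RingHom.congr_fun hcomp r).symm.trans ?_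
    rw [RingHom.comp_apply]
    exact (congrArg (Ideal.Quotient.mk I) hr).trans (map_zero _)
  rw [IsLocalization.algebraMap_mem_map_algebraMap_iff
    (Submonoid.powers (X k : GenericRing n d))] at hmem
  obtain ⟨_, ⟨N, rfl⟩, hN⟩ := hmem
  exact ⟨N, hN⟩

theorem inertiaIdeal_eq_ker :
    inertiaIdeal n d = RingHom.ker (aeval (genericZeroCoeffs d B k) : CoeffRing n d →ₐ[ℤ] B) := by
  ext r
  refine ⟨fun ⟨N, hN⟩ => aeval_genericZeroCoeffs_eq_zero_of_mem d B k (hN k), fun h => ?_⟩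
  obtain ⟨M, hM⟩ := exists_X_pow_mul_C_mem_of_aeval_genericZeroCoeffs_eq_zero d B k h
  have hl (l : Fin n) : ∃ N, X l ^ N * C r ∈ genericIdeal n d :=
    exists_X_pow_mul_C_mem_of_aeval_genericZeroCoeffs_eq_zero d
      (Localization.Away (X l : GenericRing n d)) l
      (aeval_genericZeroCoeffs_eq_zero_of_mem d _ l hM)
  choose N hN using hl
  refine ⟨Finset.univ.sup N, fun l => ?_⟩
  rw [← Nat.sub_add_cancel (Finset.le_sup (f := N) (Finset.mem_univ l)), pow_add, mul_assoc]
  exact Ideal.mul_mem_left _ _ (hN l)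

end GenericZero

theorem inertiaIdeal_isPrime (k : Fin n) : (inertiaIdeal n d).IsPrime := by
  let B := Localization.Away (X k : GenericRing n d)
  have : IsDomain B := IsLocalization.isDomain_of_le_nonZeroDivisors B
    (powers_le_nonZeroDivisors_of_noZeroDivisors (X_ne_zero k : (X k : GenericRing n d) ≠ 0))
  exact inertiaIdeal_eq_ker d B k ▸ RingHom.ker_isPrime _

/-! ### Inertia forms involve the diagonal coefficients -/

theorem algebraicIndependent_map_X_of_injective {σ S : Type*} [CommRing S]
    {φ : MvPolynomial σ ℤ →+* S} (hφ : Function.Injective φ) :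
    AlgebraicIndependent ℤ fun p => φ (X p) :=
  (algebraicIndependent_X σ ℤ).map' (f := φ.toIntAlgHom) hφ

section Elimination

variable {K : Type*} [Field K] {a : Fin n × Expo n d → K} {x : Fin n → K} {k : Fin n}

/-- The coefficients `a`, over `K[t]`, with the coefficient of `x_i ^ d` in the `i`-th form
multiplied by `t` for each `i`. Adjusting them to have a given zero gives polynomials in `t` whose
leading coefficients can be controlled. -/
def scaleDiagonal (a : Fin n × Expo n d → K) (p : Fin n × Expo n d) : Polynomial K :=
  if p.2 = pureExpo n d p.1 then Polynomial.C (a p) * Polynomial.X else Polynomial.C (a p)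

theorem eval_formOfCoeffs_scaleDiagonal (a : Fin n × Expo n d → K) (x : Fin n → K) (i : Fin n) :
    eval (fun l => Polynomial.C (x l)) (formOfCoeffs (scaleDiagonal a) i) =
      Polynomial.C (eval x (formOfCoeffs a i)) +
        Polynomial.C (a (i, pureExpo n d i) * x i ^ d) * (Polynomial.X - 1) := by
  have hC : eval (fun l => Polynomial.C (x l)) (map Polynomial.C (formOfCoeffs a i)) =
      Polynomial.C (eval x (formOfCoeffs a i)) := by
    rw [eval_map]
    exact (eval₂_comp ..).symm
  rw [formOfCoeffs_eq_add_of_forall_ne (u := fun p => Polynomial.C (a p)) fun α hα => if_neg hα,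
    ← map_formOfCoeffs, map_add, hC]
  simp only [scaleDiagonal, if_true, map_sub, map_mul, map_pow, eval_C, eval_X]
  ring

theorem leadingCoeff_adjustCoeffs_scaleDiagonal (hd : 1 ≤ d) (ha : ∀ p, a p ≠ 0) (hxk : x k = 1)
    (hx : ∀ i, i ≠ k → a (i, pureExpo n d i) * x i ^ d = -a (i, pureExpo n d k))
    {p : Fin n × Expo n d} (hp : p ≠ (k, pureExpo n d k)) :
    (adjustCoeffs k (scaleDiagonal a) (fun l => Polynomial.C (x l)) p).leadingCoeff = a p := by
  obtain ⟨i, α⟩ := p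
  by_cases hα : α = pureExpo n d k
  · subst hα
    have hik : i ≠ k := by rintro rfl; exact hp rfl
    have hne : pureExpo n d k ≠ pureExpo n d i := fun h => hik (pureExpo_injective hd h).symm
    have hlin : adjustCoeffs k (scaleDiagonal a) (fun l => Polynomial.C (x l))
        (i, pureExpo n d k) = Polynomial.C (a (i, pureExpo n d k)) * Polynomial.X +
          Polynomial.C (-eval x (formOfCoeffs a i)) := by
      rw [adjustCoeffs, if_pos rfl, eval_formOfCoeffs_scaleDiagonal, hx i hik, hxk,
        scaleDiagonal, if_neg hne]
      simp only [Polynomial.C_1, Ring.inverse_one, one_pow, Polynomial.C_neg]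
      ring
    rw [hlin, Polynomial.leadingCoeff_linear (ha _)]
  · rw [adjustCoeffs, if_neg hα, scaleDiagonal]
    split_ifs <;> simp

/-- The system with the coefficients `adjustCoeffs k (scaleDiagonal a) x` vanishes at `x`, which is
chosen so that the leading coefficients, apart from that at `(k, x_k ^ d)`, are those of `a`. -/
theorem eq_zero_of_rename_mem_inertiaIdeal_of_algebraicIndependent (hd : 1 ≤ d)
    (ha : AlgebraicIndependent ℤ a) (hxk : x k = 1)
    (hx : ∀ i, i ≠ k → a (i, pureExpo n d i) * x i ^ d = -a (i, pureExpo n d k))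
    {s : MvPolynomial {p : Fin n × Expo n d // p ≠ (k, pureExpo n d k)} ℤ}
    (hs : rename Subtype.val s ∈ inertiaIdeal n d) : s = 0 := by
  obtain ⟨N, hN⟩ := hs
  have hxk' : IsUnit (Polynomial.C (x k)) := by simp [hxk]
  have hzero := aeval_eq_zero_of_X_pow_mul_C_mem (x := fun l => Polynomial.C (x l)) (hN k)
    (eval_formOfCoeffs_adjustCoeffs (k := k) hxk' (scaleDiagonal a)) hxk'.ne_zero
  rw [aeval_rename] at hzero
  refine algebraicIndependent_iff.1 (algebraicIndependent_of_leadingCoeff ?_) s hzero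
  have hlead (p : {p : Fin n × Expo n d // p ≠ (k, pureExpo n d k)}) :=
    leadingCoeff_adjustCoeffs_scaleDiagonal hd (fun p => ha.ne_zero p) hxk hx p.2
  simpa only [Function.comp_apply, hlead, Function.comp_def] using ha.comp _ Subtype.val_injective

theorem eq_zero_of_rename_mem_inertiaIdeal_of_isAlgClosed [IsAlgClosed K] (hd : 1 ≤ d)
    (ha : AlgebraicIndependent ℤ a)
    {s : MvPolynomial {p : Fin n × Expo n d // p ≠ (k, pureExpo n d k)} ℤ}
    (hs : rename Subtype.val s ∈ inertiaIdeal n d) : s = 0 := by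
  have hroot (i : Fin n) : ∃ y : K, a (i, pureExpo n d i) * y ^ d = -a (i, pureExpo n d k) := by
    obtain ⟨y, hy⟩ := IsAlgClosed.exists_pow_nat_eq
      (-a (i, pureExpo n d k) / a (i, pureExpo n d i)) hd
    exact ⟨y, by rw [hy, mul_div_cancel₀ _ (ha.ne_zero _)]⟩
  choose y hy using hroot
  refine eq_zero_of_rename_mem_inertiaIdeal_of_algebraicIndependent (x := Function.update y k 1)
    hd ha (Function.update_self ..) (fun i hi => ?_) hs
  rw [Function.update_of_ne hi, hy]

end Elimination

theorem comap_rename_inertiaIdeal_eq_bot (hd : 1 ≤ d) (k : Fin n) :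
    (inertiaIdeal n d).comap (rename (R := ℤ)
      (Subtype.val : {p : Fin n × Expo n d // p ≠ (k, pureExpo n d k)} → _)) = ⊥ := by
  let F := FractionRing (CoeffRing n d)
  let φ := (algebraMap F (AlgebraicClosure F)).comp (algebraMap (CoeffRing n d) F)
  have hφ : Function.Injective φ :=
    (algebraMap F _).injective.comp (IsFractionRing.injective (CoeffRing n d) F)
  exact (Submodule.eq_bot_iff _).2 fun s hs =>
    eq_zero_of_rename_mem_inertiaIdeal_of_isAlgClosed hd
      (algebraicIndependent_map_X_of_injective hφ) hs

/-! ### Macaulay matrices -/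

section Macaulay

variable {S T : Type*} [CommRing S] [CommRing T] {f : Fin n → MvPolynomial (Fin n) S} {e : ℕ}

/-- The Macaulay matrix in degree `e + d` of a system of forms of degree `d`: its rows list the
coefficients of the products `x^γ f_i` with `|γ| = e`. For the generic forms, its maximal minors are
inertia forms. -/
def macaulayMatrix (f : Fin n → MvPolynomial (Fin n) S) (d e : ℕ) :
    Matrix (Fin n × Expo n e) (Expo n (e + d)) S :=
  Matrix.of fun c β => coeff β.1 (monomial c.2.1 1 * f c.1)

theorem map_macaulayMatrix (φ : S →+* T) :
    (macaulayMatrix f d e).map φ = macaulayMatrix (fun i => map φ (f i)) d e := by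
  ext c β
  rw [Matrix.map_apply, macaulayMatrix, macaulayMatrix, Matrix.of_apply, Matrix.of_apply,
    ← coeff_map, map_mul, map_monomial, map_one]

theorem sum_macaulayMatrix_smul_monomial (hf : ∀ i, (f i).IsHomogeneous d)
    (c : Fin n × Expo n e) :
    ∑ β : Expo n (e + d), macaulayMatrix f d e c β • monomial β.1 (1 : S) =
      monomial c.2.1 1 * f c.1 := by
  simp only [smul_monomial, smul_eq_mul, mul_one]
  exact sum_monomial_coeff_of_isHomogeneous
    ((isHomogeneous_monomial 1 c.2.degree_eq).mul (hf c.1))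

theorem X_pow_mul_C_det_submatrix_macaulayMatrix_mem (hf : ∀ i, (f i).IsHomogeneous d)
    (a : Expo n (e + d) → Fin n × Expo n e) (k : Fin n) :
    X k ^ (e + d) * C ((macaulayMatrix f d e).submatrix a id).det ∈
      Ideal.span (Set.range f) := by
  have hspan := det_smul_mem_span ((macaulayMatrix f d e).submatrix a id)
    (fun β => monomial β.1 (1 : S)) (pureExpo n (e + d) k)
  simp only [Matrix.submatrix_apply, id, sum_macaulayMatrix_smul_monomial hf] at hspan
  rw [monomial_pureExpo, C_1, one_mul, smul_eq_C_mul, mul_comm] at hspan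
  have hle : Submodule.span S (Set.range fun c => monomial (a c).2.1 1 * f (a c).1) ≤
      (Ideal.span (Set.range f)).restrictScalars S := by
    rw [Submodule.span_le]
    rintro _ ⟨c, rfl⟩
    exact Ideal.mul_mem_left _ _ (Ideal.subset_span ⟨_, rfl⟩)
  exact hle hspan

theorem det_submatrix_macaulayMatrix_genericForm_mem_inertiaIdeal
    (a : Expo n (e + d) → Fin n × Expo n e) :
    ((macaulayMatrix (genericForm n d) d e).submatrix a id).det ∈ inertiaIdeal n d :=
  ⟨e + d, X_pow_mul_C_det_submatrix_macaulayMatrix_mem (isHomogeneous_formOfCoeffs X) a⟩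

theorem coeff_mem_span_row_macaulayMatrix (hf : ∀ i, (f i).IsHomogeneous d)
    {q : MvPolynomial (Fin n) S} (hq : q ∈ Ideal.span (Set.range f)) :
    (fun β : Expo n (e + d) => coeff β.1 q) ∈
      Submodule.span S (Set.range (macaulayMatrix f d e).row) := by
  let π : MvPolynomial (Fin n) S →ₗ[S] Expo n (e + d) → S := LinearMap.pi fun β => lcoeff S β.1
  have hmonomial (i : Fin n) (γ : Fin n →₀ ℕ) (c : S) : π (monomial γ c * f i) ∈
      Submodule.span S (Set.range (macaulayMatrix f d e).row) := by
    have hsmul : monomial γ c * f i = c • (monomial γ 1 * f i) := by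
      rw [← smul_mul_assoc, smul_monomial, smul_eq_mul, mul_one]
    rw [hsmul, map_smul]
    refine Submodule.smul_mem _ c ?_
    by_cases hγ : γ.degree = e
    · exact Submodule.subset_span ⟨(i, ⟨γ, mem_finsuppAntidiag_univ_iff.2 hγ⟩), rfl⟩
    · have hzero : π (monomial γ 1 * f i) = 0 := by
        refine funext fun β => ((isHomogeneous_monomial 1 rfl).mul (hf i)).coeff_eq_zero ?_
        rw [β.degree_eq]
        omega
      exact hzero ▸ Submodule.zero_mem _
  change π q ∈ _
  obtain ⟨c, rfl⟩ := Ideal.mem_span_range_iff_exists_fun.1 hq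
  rw [map_sum]
  refine sum_mem fun i _ => ?_
  rw [(c i).as_sum, Finset.sum_mul, map_sum]
  exact sum_mem fun γ _ => hmonomial i γ _

/-- Every monomial of degree greater than `n N` is divisible by some `x_k ^ N`. -/
theorem span_row_macaulayMatrix_eq_top (hf : ∀ i, (f i).IsHomogeneous d) {N : ℕ}
    (he : n * N < e + d) (hN : ∀ k, X k ^ N ∈ Ideal.span (Set.range f)) :
    Submodule.span S (Set.range (macaulayMatrix f d e).row) = ⊤ := by
  rw [eq_top_iff, ← (Pi.basisFun S (Expo n (e + d))).span_eq, Submodule.span_le]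
  rintro _ ⟨β, rfl⟩
  obtain ⟨k, hk⟩ : ∃ k, N ≤ β.1 k := by
    by_contra! h
    have hsum : ∑ k, β.1 k ≤ ∑ _k : Fin n, N := Finset.sum_le_sum fun k _ => (h k).le
    rw [← Finsupp.degree_eq_sum, β.degree_eq, Finset.sum_const, Finset.card_univ, Fintype.card_fin,
      smul_eq_mul] at hsum
    omega
  have hmem : monomial β.1 (1 : S) ∈ Ideal.span (Set.range f) := by
    rw [← tsub_add_cancel_of_le (Finsupp.single_le_iff.2 hk), ← mul_one (1 : S), ← monomial_mul,
      ← X_pow_eq_monomial]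
    exact Ideal.mul_mem_left _ _ (hN k)
  have hbasis : Pi.basisFun S (Expo n (e + d)) β = fun b => coeff b.1 (monomial β.1 (1 : S)) := by
    funext b
    rw [Pi.basisFun_apply, Pi.single_apply, coeff_monomial]
    exact if_congr (eq_comm.trans Subtype.ext_iff) rfl rfl
  rw [SetLike.mem_coe, hbasis]
  exact coeff_mem_span_row_macaulayMatrix hf hmem

end Macaulay

theorem exists_mem_inertiaIdeal_aeval_ne_zero {K : Type*} [Field K] (hd : 1 ≤ d)
    (u : Fin n × Expo n d → K) {N : ℕ}
    (hN : ∀ k, X k ^ N ∈ Ideal.span (Set.range (formOfCoeffs u))) :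
    ∃ r ∈ inertiaIdeal n d, aeval u r ≠ 0 := by
  obtain ⟨a, ha⟩ := exists_det_submatrix_ne_zero
    (span_row_macaulayMatrix_eq_top (e := n * N) (isHomogeneous_formOfCoeffs u) (by omega) hN)
  refine ⟨_, det_submatrix_macaulayMatrix_genericForm_mem_inertiaIdeal a, ?_⟩
  have hmap : macaulayMatrix (formOfCoeffs u) d (n * N) =
      (macaulayMatrix (genericForm n d) d (n * N)).map
        (aeval u : CoeffRing n d →ₐ[ℤ] K).toRingHom := by
    rw [map_macaulayMatrix]
    simp only [map_aeval_genericForm]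
  rw [hmap, Matrix.submatrix_map] at ha
  exact (AlgHom.map_det _ _).trans_ne ha

/-! ### The generic resultant -/

theorem isPrincipal_inertiaIdeal (hd : 1 ≤ d) : (inertiaIdeal n d).IsPrincipal := by
  rcases isEmpty_or_nonempty (Fin n) with _ | ⟨⟨k⟩⟩
  · have htop : inertiaIdeal n d = ⊤ := (Ideal.eq_top_iff_one _).2 ⟨0, isEmptyElim⟩
    exact htop ▸ inferInstance
  · exact isPrincipal_of_comap_rename_eq_bot (k, pureExpo n d k) (inertiaIdeal_isPrime k)
      (comap_rename_inertiaIdeal_eq_bot hd k)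

theorem aeval_ne_zero_of_inertiaIdeal_eq_span {K : Type*} [Field K] (hd : 1 ≤ d)
    {R : CoeffRing n d} (hR : inertiaIdeal n d = Ideal.span {R}) {u : Fin n × Expo n d → K} {N : ℕ}
    (hN : ∀ k, X k ^ N ∈ Ideal.span (Set.range (formOfCoeffs u))) : aeval u R ≠ 0 := by
  obtain ⟨r, hr, hr0⟩ := exists_mem_inertiaIdeal_aeval_ne_zero hd u hN
  rw [hR, Ideal.mem_span_singleton] at hr
  obtain ⟨s, rfl⟩ := hr
  rw [map_mul] at hr0
  exact left_ne_zero_of_mul hr0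

/-- No prime `p` divides this integer, because the forms `x_1 ^ d, …, x_n ^ d` have no nontrivial
common zero over `ℤ/p` either. -/
theorem isUnit_eval_purePowers (hd : 1 ≤ d) {R : CoeffRing n d}
    (hR : inertiaIdeal n d = Ideal.span {R}) : IsUnit (eval (purePowers n d) R) := by
  rw [Int.isUnit_iff_natAbs_eq, Nat.eq_one_iff_not_exists_prime_dvd]
  intro p hp hdvd
  have : Fact p.Prime := ⟨hp⟩
  have hne : aeval (fun q => (purePowers n d q : ZMod p)) R ≠ 0 :=
    aeval_ne_zero_of_inertiaIdeal_eq_span hd hR (N := d) fun k =>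
      Ideal.subset_span ⟨k, formOfCoeffs_purePowers k⟩
  have hcast : aeval (fun q => (purePowers n d q : ZMod p)) R =
      ((eval (purePowers n d) R : ℤ) : ZMod p) := by
    rw [← aeval_eq_eval]
    exact aeval_algebraMap_apply (ZMod p) (purePowers n d) R
  rw [hcast, Ne, ZMod.intCast_zmod_eq_zero_iff_dvd] at hne
  exact hne (Int.natCast_dvd.2 hdvd)

theorem exists_isGenericResultant (hd : 1 ≤ d) : ∃ R, IsGenericResultant n d R := by
  obtain ⟨R, hR⟩ := isPrincipal_inertiaIdeal (n := n) hd
  rcases Int.isUnit_iff.1 (isUnit_eval_purePowers hd hR) with h | h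
  · exact ⟨R, hR, h⟩
  · exact ⟨-R, hR.trans (Ideal.span_singleton_neg R).symm, by rw [map_neg, h, neg_neg]⟩

theorem isGenericResultant_genericResultant (hd : 1 ≤ d) :
    IsGenericResultant n d (genericResultant n d) := by
  have h := exists_isGenericResultant (n := n) hd
  rw [genericResultant, dif_pos h]
  exact h.choose_spec

theorem resultant_ne_zero {K : Type*} [Field K] [IsAlgClosed K] (hd : 1 ≤ d)
    {f : Fin n → MvPolynomial (Fin n) K} (hf : ∀ i, (f i).IsHomogeneous d)
    (h : ∀ x : Fin n → K, (∀ i, eval x (f i) = 0) → x = 0) : resultant d f ≠ 0 := by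
  have hrad (k : Fin n) : X k ∈ (Ideal.span (Set.range f)).radical := by
    rw [← vanishingIdeal_zeroLocus_eq_radical (k := K) (K := K), mem_vanishingIdeal_iff]
    intro x hx
    rw [zeroLocus_span] at hx
    rw [aeval_X, h x fun i => hx (f i) ⟨i, rfl⟩, Pi.zero_apply]
  choose N hN using hrad
  refine aeval_ne_zero_of_inertiaIdeal_eq_span hd (isGenericResultant_genericResultant hd).1
    (N := Finset.univ.sup N) fun k => ?_
  rw [formOfCoeffs_coeff hf]
  exact Ideal.pow_mem_of_pow_mem _ (hN k) (Finset.le_sup (Finset.mem_univ k))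

/-! ### Dominant coefficients -/

section Tensors

theorem isHomogeneous_tensorForm {K : Type*} [CommRing K] (A : Tensor K (d + 1) n) (i : Fin n) :
    (tensorForm A i).IsHomogeneous d := by
  refine IsHomogeneous.sum _ _ _ fun α _ => ?_
  have h : (∏ k, X (α k) : MvPolynomial (Fin n) K).IsHomogeneous (∑ _k : Fin d, 1) :=
    IsHomogeneous.prod _ _ _ fun k _ => isHomogeneous_X _ _
  simpa only [Finset.sum_const, Finset.card_univ, Fintype.card_fin, smul_eq_mul, mul_one, zero_add]
    using (isHomogeneous_C (Fin n) (A (Fin.cons i α))).mul h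

theorem eval_tensorForm {K : Type*} [CommRing K] (A : Tensor K (d + 1) n) (i : Fin n)
    (x : Fin n → K) :
    eval x (tensorForm A i) = ∑ α : Fin d → Fin n, A (Fin.cons i α) * ∏ k, x (α k) := by
  simp only [tensorForm, map_sum, map_mul, eval_C, map_prod, eval_X]

variable {K : Type*} [NormedField K] {A : Tensor K (d + 1) n}

theorem norm_le_sum_of_eval_tensorForm_eq_zero {x : Fin n → K} {i j : Fin n}
    (hx : eval x (tensorForm A j) = 0) (hxi : x i ≠ 0) (hmax : ∀ k, ‖x k‖ ≤ ‖x i‖) :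
    ‖A (Fin.cons j fun _ => i)‖ ≤ ∑ α with α ≠ fun _ => i, ‖A (Fin.cons j α)‖ := by
  have hpos : 0 < ‖x i‖ ^ d := pow_pos (norm_pos_iff.2 hxi) d
  have hprod (α : Fin d → Fin n) : ‖∏ k, x (α k)‖ ≤ ‖x i‖ ^ d := by
    rw [norm_prod, ← Fin.prod_const]
    exact Finset.prod_le_prod (fun _ _ => norm_nonneg _) fun k _ => hmax (α k)
  have hterm : A (Fin.cons j fun _ => i) * x i ^ d =
      -∑ α with α ≠ fun _ => i, A (Fin.cons j α) * ∏ k, x (α k) := by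
    rw [eval_tensorForm, ← Finset.add_sum_erase _ _ (Finset.mem_univ fun _ => i),
      ← Finset.filter_ne', Fin.prod_const] at hx
    exact eq_neg_of_add_eq_zero_left hx
  refine le_of_mul_le_mul_right ?_ hpos
  calc ‖A (Fin.cons j fun _ => i)‖ * ‖x i‖ ^ d
      = ‖∑ α with α ≠ fun _ => i, A (Fin.cons j α) * ∏ k, x (α k)‖ := by
        rw [← norm_pow, ← norm_mul, hterm, norm_neg]
    _ ≤ ∑ α with α ≠ fun _ => i, ‖A (Fin.cons j α)‖ * ‖x i‖ ^ d :=
        norm_sum_le_of_le _ fun α _ => by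
          rw [norm_mul]
          gcongr
          exact hprod α
    _ = (∑ α with α ≠ fun _ => i, ‖A (Fin.cons j α)‖) * ‖x i‖ ^ d := (Finset.sum_mul ..).symm

theorem eq_zero_of_forall_exists_dominant
    (hA : ∀ i, ∃ j, ∑ α with α ≠ fun _ => i, ‖A (Fin.cons j α)‖ < ‖A (Fin.cons j fun _ => i)‖)
    {x : Fin n → K} (hx : ∀ j, eval x (tensorForm A j) = 0) : x = 0 := by
  by_contra hne
  obtain ⟨l, hl⟩ := Function.ne_iff.1 hne
  have : Nonempty (Fin n) := ⟨l⟩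
  obtain ⟨i, hi⟩ := Finite.exists_max fun k => ‖x k‖
  have hxi : x i ≠ 0 := norm_pos_iff.1 ((norm_pos_iff.2 hl).trans_le (hi l))
  obtain ⟨j, hj⟩ := hA i
  exact hj.not_ge (norm_le_sum_of_eval_tensorForm_eq_zero (hx j) hxi hi)

end Tensors

theorem cons_const {α : Type*} (d : ℕ) (a : α) :
    (Fin.cons a fun _ => a : Fin (d + 1) → α) = fun _ => a :=
  Fin.cons_self_tail fun _ => a

theorem offDiagSum_add_norm (A : Tensor ℂ (d + 1) n) (j : Fin n) :
    offDiagSum A j + ‖A fun _ => j‖ = ∑ α, ‖A (Fin.cons j α)‖ := by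
  rw [offDiagSum, Finset.filter_ne', ← Finset.sum_erase_add _ _ (Finset.mem_univ fun _ => j),
    cons_const]

theorem exists_dominant_of_offDiagSum {A : Tensor ℂ (d + 1) n} {i : Fin n}
    (h : ‖A (fun _ => i)‖ > offDiagSum A i ∨
      ∃ j, ‖A (fun _ => j)‖ < 2 * ‖A (Fin.cons j fun _ => i)‖ - offDiagSum A j) :
    ∃ j, ∑ α with α ≠ fun _ => i, ‖A (Fin.cons j α)‖ < ‖A (Fin.cons j fun _ => i)‖ := by
  rcases h with h | ⟨j, h⟩
  · refine ⟨i, ?_⟩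
    rw [cons_const]
    exact h
  · refine ⟨j, ?_⟩
    have hsum := offDiagSum_add_norm A j
    rw [← Finset.sum_erase_add _ _ (Finset.mem_univ fun _ => i), ← Finset.filter_ne'] at hsum
    linarith

end TensorDet

end

theorem mainTheorem3_general {K : Type*} [NormedField K] [IsAlgClosed K] {d n : ℕ} (hd : 1 ≤ d)
    (A : TensorDet.Tensor K (d + 1) n)
    (hA : ∀ i, ∃ j, ∑ α with α ≠ fun _ => i, ‖A (Fin.cons j α)‖ < ‖A (Fin.cons j fun _ => i)‖) :
    TensorDet.det A ≠ 0 :=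
  TensorDet.resultant_ne_zero hd (TensorDet.isHomogeneous_tensorForm A) fun _ =>
    TensorDet.eq_zero_of_forall_exists_dominant hA

theorem mainTheorem3 (d n : ℕ) (hd : 1 ≤ d) (A : TensorDet.Tensor ℂ (d + 1) n)
    (hA : ∀ i : Fin n,
      ‖A (fun _ => i)‖ > TensorDet.offDiagSum A i ∨
      ∃ j : Fin n, j ≠ i ∧
        ‖A (fun _ => j)‖ < 2 * ‖A (Fin.cons j fun _ => i)‖ - TensorDet.offDiagSum A j) :
    TensorDet.det A ≠ 0 :=
  mainTheorem3_general hd A fun i =>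
    TensorDet.exists_dominant_of_offDiagSum ((hA i).imp_right (Exists.imp fun _ => And.right))
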